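/- All graphs are finite, simple and nonempty. Let $G=(V,E)$ be a graph. A $k$-list-assignment of $G$ gives each vertex $v$ a set $L(v)\subset\mathbb N$ with $|L(v)|=k$. A proper $L$-colouring is a map $c:V\to\mathbb N$ with $c(v)\in L(v)$ for every $v\in V$ and $c(u)\neq c(v)$ for every edge $uv$. An $L$-packing of size $k$ is a family of $k$ pairwise disjoint proper $L$-colourings $c_1,\dots,c_k$, i.e. $c_i(v)\ne c_j(v)$ for all $v\in V$ and $i\neq j$. A $k$-fold correspondence-cover of $G$ is a pair $(L,H)$ of a graph $H$ and a partition $\{L(v)\}_{v\in V}$ of $V(H)$ into cliques of size $k$ such that the edges of $H$ between $L(u)$ and $L(v)$ form a (possibly empty, not necessarily perfect) matching if $uv\in E$, and there are no such edges if $u\neq v$ and $uv\notin E$. The list-cover given by a $k$-list-assignment $L$ is the $k$-fold correspondence-cover with vertices $(v,x)$, $v\in V$, $x\in L(v)$, in which each $\{v\}\times L(v)$ is a clique and $(u,x)$, $(v,x)$ are adjacent whenever $uv\in E$ and $x\in L(u)\cap L(v)$. Let $\chi(H)$ be the chromatic number and $\chi_f(H)$ the fractional chromatic number of $H$. Define the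 following as the least positive integer $k$ such that: - $\chi_\ell(G)$: for every $k$-list-assignment $L$ of $G$ there is a proper $L$-colouring; - $\chi_\ell^\bullet(G)$: every $k$-fold list-cover $H$ of $G$ has $\chi_f(H)=k$; - $\chi_\ell^\star(G)$: for every $k$-list-assignment $L$ of $G$ there is an $L$-packing of size $k$; - $\chi_c(G)$: every $k$-fold correspondence-cover $(L,H)$ of $G$ has an independent set of size $|V|$ in $H$; - $\chi_c^\bullet(G)$: every $k$-fold correspondence-cover $(L,H)$ of $G$ has $\chi_f(H)=k$; - $\chi_c^\star(G)$: every $k$-fold correspondence-cover $(L,H)$ of $G$ has $\chi(H)=k$. **Proposition 1.9.** Each of the strict inequalities $\chi_\ell<\chi_\ell^\bullet$, $\chi_\ell^\bullet<\chi_\ell^\star$, $\chi_c<\chi_c^\bullet$ and $\chi_c^\bullet<\chi_c^\star$ is attained by some graph. More precisely: 1. $\chi_\ell(C_{2n})<\chi_\ell^\bullet(C_{2n})$ for every even cycle $C_{2n}$, $n\ge 2$; 2. $\chi_\ell^\bullet(F_7)<\chi_\ell^\star(F_7)$, where the fan $F_7$ is the path on $6$ vertices together with a universal vertex; 3. $\chi_c(K_{3,3})<\chi_c^\bullet(K_{3,3})$;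 4. $\chi_c^\bullet(C_n)<\chi_c^\star(C_n)$ for every cycle $C_n$, $n\ge 3$. -/

import Mathlib

namespace ListPacking

/-- The least positive integer `k` with `P k`, as an extended natural number (`⊤` if there is no
such `k`).  Only positive `k` count: lists and covers have fold number at least one, whereas the
`0`-fold cover has no vertices and would be packed by zero colourings. -/
noncomputable def leastPos (P : ℕ → Prop) : ℕ∞ :=
  ⨅ k ∈ {k : ℕ | 0 < k ∧ P k}, (k : ℕ∞)

/-- The fractional chromatic number of a finite graph: the minimum total weight of a nonnegative
weighting of the independent sets in which every vertex is covered with total weight at least 1. -/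
noncomputable def fractionalChromaticNumber {W : Type*} [Fintype W] (H : SimpleGraph W) : ℝ :=
  open Classical in
  sInf {t : ℝ | ∃ w : Finset W → ℝ,
    (∀ S, 0 ≤ w S) ∧
    (∀ S : Finset W, ¬ H.IsIndepSet (S : Set W) → w S = 0) ∧
    (∀ x, 1 ≤ ∑ S ∈ Finset.univ.filter (fun S : Finset W => x ∈ S), w S) ∧
    t = ∑ S, w S}

section Lists

variable {V : Type*}

/-- A `k`-list-assignment: every vertex receives a list of exactly `k` colours. -/
def IsListAssignment (k : ℕ) (L : V → Finset ℕ) : Prop :=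
  ∀ v, (L v).card = k

/-- A proper `L`-colouring of `G`. -/
def IsListColouring (G : SimpleGraph V) (L : V → Finset ℕ) (c : V → ℕ) : Prop :=
  (∀ v, c v ∈ L v) ∧ ∀ u v, G.Adj u v → c u ≠ c v

/-- An `L`-packing of size `k`: a family of `k` pairwise disjoint proper `L`-colourings. -/
def IsListPacking (G : SimpleGraph V) (L : V → Finset ℕ) (k : ℕ) (c : Fin k → V → ℕ) : Prop :=
  (∀ i, IsListColouring G L (c i)) ∧ ∀ i j, i ≠ j → ∀ v, c i v ≠ c j v

/-- The list-cover of `G` given by a list-assignment `L`: its vertices are the pairs `(v, x)` with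
`x ∈ L v`, each list is made a clique, and equal colours at adjacent vertices are joined. -/
def listCover (G : SimpleGraph V) (L : V → Finset ℕ) : SimpleGraph ((v : V) × L v) where
  Adj p q := p ≠ q ∧ (p.1 = q.1 ∨ (G.Adj p.1 q.1 ∧ (p.2 : ℕ) = (q.2 : ℕ)))
  symm := ⟨fun _ _ h => ⟨h.1.symm, h.2.imp Eq.symm fun h' => ⟨h'.1.symm, h'.2.symm⟩⟩⟩
  loopless := ⟨fun _ h => h.1 rfl⟩

/-- The list chromatic number `χ_ℓ(G)`. -/
noncomputable def listChromaticNumber (G : SimpleGraph V) : ℕ∞ :=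
  leastPos fun k => ∀ L : V → Finset ℕ, IsListAssignment k L → ∃ c, IsListColouring G L c

/-- The list packing number `χ_ℓ^⋆(G)`. -/
noncomputable def listPackingNumber (G : SimpleGraph V) : ℕ∞ :=
  leastPos fun k => ∀ L : V → Finset ℕ, IsListAssignment k L → ∃ c, IsListPacking G L k c

/-- The fractional list packing number `χ_ℓ^•(G)`. -/
noncomputable def fractionalListPackingNumber [Fintype V] (G : SimpleGraph V) : ℕ∞ :=
  leastPos fun k => ∀ L : V → Finset ℕ, IsListAssignment k L →
    fractionalChromaticNumber (listCover G L) = k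

end Lists

section Correspondence

variable {V : Type*}

/-- `(L, H)` is a correspondence-cover of `G`. -/
structure IsCorrespondenceCover {W : Type*} (G : SimpleGraph V) (L : V → Finset W)
    (H : SimpleGraph W) : Prop where
  /-- The sets `L v` partition the vertex set of `H`. -/
  partition : ∀ x, ∃! v, x ∈ L v
  /-- There are no edges between the lists of distinct nonadjacent vertices. -/
  empty : ∀ u v, u ≠ v → ¬ G.Adj u v → ∀ x ∈ L u, ∀ y ∈ L v, ¬ H.Adj x y
  /-- The edges between the lists of adjacent vertices form a matching (possibly not perfect). -/
  matching : ∀ u v, G.Adj u v → ∀ x ∈ L u, ∀ y ∈ L v, ∀ z ∈ L v, H.Adj x y → H.Adj x z → y = z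
  /-- Each list is a clique. -/
  clique : ∀ v, H.IsClique (L v : Set W)

/-- Every `k`-fold correspondence-cover graph `H` of `G` satisfies `P H`.  For finite `G` every
such cover is finite, so it is isomorphic to one whose vertex type lies in `Type`. -/
def ForallCover (G : SimpleGraph V) (k : ℕ)
    (P : ∀ {W : Type} [Fintype W], SimpleGraph W → Prop) : Prop :=
  ∀ (W : Type) [Fintype W] (L : V → Finset W) (H : SimpleGraph W),
    IsCorrespondenceCover G L H → (∀ v, (L v).card = k) → P H

/-- The correspondence chromatic number `χ_c(G)`. -/
noncomputable def corrChromaticNumber [Fintype V] (G : SimpleGraph V) : ℕ∞ :=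
  leastPos fun k => ForallCover G k fun {W} _ H =>
    ∃ I : Finset W, H.IsIndepSet (I : Set W) ∧ I.card = Fintype.card V

/-- The correspondence packing number `χ_c^⋆(G)`. -/
noncomputable def corrPackingNumber (G : SimpleGraph V) : ℕ∞ :=
  leastPos fun k => ForallCover G k fun H => H.chromaticNumber = k

/-- The fractional correspondence packing number `χ_c^•(G)`. -/
noncomputable def fractionalCorrPackingNumber (G : SimpleGraph V) : ℕ∞ :=
  leastPos fun k => ForallCover G k fun H => fractionalChromaticNumber H = k

end Correspondence

/-- The fan on `m + 1` vertices: a path on `m` vertices (the vertices `some i`) together with one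
universal vertex (the vertex `none`). -/
def fanGraph (m : ℕ) : SimpleGraph (Option (Fin m)) where
  Adj a b := a ≠ b ∧ (a = none ∨ b = none ∨
    ∃ i j, a = some i ∧ b = some j ∧ (SimpleGraph.pathGraph m).Adj i j)
  symm := ⟨fun _ _ h => ⟨h.1.symm, by
    rcases h.2 with h | h | ⟨i, j, hi, hj, h⟩
    · exact Or.inr (Or.inl h)
    · exact Or.inl h
    · exact Or.inr (Or.inr ⟨j, i, hj, hi, h.symm⟩)⟩⟩
  loopless := ⟨fun _ h => h.1 rfl⟩

end ListPacking

namespace ListPacking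

/-! Each inequality is witnessed by one `k` (2 for even cycles and lists, 3 otherwise) that has the
weaker property, while no positive `j ≤ k` has the stronger one. Monotonicity in `k` is not used, so
smaller values are refuted separately.

Fractional chromatic number at most 3 comes from six independent transversals covering every vertex
of the cover twice. On a fan, each hub colour leaves lists of size two along the path, which carry
two disjoint colourings. On a cycle, all matchings but the closing one can be made the identity, and
a finite table handles the closing permutation.

Fractional chromatic number above `k` comes from LP duality (`lt_fractionalChromaticNumber`): some
set `U` has more than `k * m` vertices, yet each independent transversal meets it at most `m` times.
For even cycles `U` is one vertex that no list colouring uses; for `K_{3,3}` it has ten vertices and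
`m = 3`.

Integral packings are excluded by a sign count around the cycle (`not_colorable_twist`) and by a
short forcing argument on the fan (`not_exists_fan_triples`). -/

lemma leastPos_lt_leastPos {P Q : ℕ → Prop} {k : ℕ} (hk : 0 < k) (hP : P k)
    (hQ : ∀ j, 0 < j → j ≤ k → ¬ Q j) : leastPos P < leastPos Q := by
  have h1 : leastPos P ≤ k := iInf₂_le (f := fun (j : ℕ) _ => (j : ℕ∞)) k ⟨hk, hP⟩
  have h2 : ((k + 1 : ℕ) : ℕ∞) ≤ leastPos Q := by
    refine le_iInf₂ fun j hj => ?_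
    have : k + 1 ≤ j := by
      by_contra h
      exact hQ j hj.1 (by omega) hj.2
    exact_mod_cast this
  refine h1.trans_lt (lt_of_lt_of_le ?_ h2)
  exact_mod_cast Nat.lt_succ_self k

/-! ### Bounds for the fractional chromatic number by LP duality -/

section Fractional

open Finset

variable {W : Type*} [Fintype W] (H : SimpleGraph W)

/-- Weak linear programming duality for the fractional chromatic number. -/
lemma sum_le_mul_fractionalChromaticNumber (y : W → ℝ) (hy : ∀ x, 0 ≤ y x) (D : ℝ) (hD : 0 < D)
    (h : ∀ S : Finset W, H.IsIndepSet (S : Set W) → ∑ x ∈ S, y x ≤ D) :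
    ∑ x, y x ≤ D * fractionalChromaticNumber H := by
  classical
  rw [mul_comm, ← div_le_iff₀ hD]
  unfold fractionalChromaticNumber
  apply le_csInf
  -- Weight 1 on every singleton is feasible, so the infimum is over a nonempty set.
  · refine ⟨_, fun S => if S.card = 1 then 1 else 0, fun S => by positivity, ?_, ?_, rfl⟩
    · intro S hS
      refine if_neg fun hc => ?_
      obtain ⟨a, rfl⟩ := card_eq_one.1 hc
      exact hS (by simp [SimpleGraph.IsIndepSet])
    · intro x
      refine le_trans ?_ (single_le_sum (f := fun S : Finset W => if S.card = 1 then (1 : ℝ) else 0)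
        (fun S _ => by positivity) (show ({x} : Finset W) ∈ _ by simp))
      simp
  · rintro t ⟨w, hw0, hwi, hw1, rfl⟩
    rw [div_le_iff₀ hD]
    calc ∑ x, y x ≤ ∑ x, y x * ∑ S ∈ univ.filter (fun S : Finset W => x ∈ S), w S :=
          sum_le_sum fun x _ => le_mul_of_one_le_right (hy x) (by convert hw1 x)
      _ = ∑ S : Finset W, w S * ∑ x ∈ S, y x := by
          simp_rw [mul_sum, sum_filter]
          rw [sum_comm]
          refine sum_congr rfl fun S _ => ?_
          rw [← sum_filter]
          simp [mul_comm]
      _ ≤ ∑ S : Finset W, w S * D := by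
          refine sum_le_sum fun S _ => ?_
          by_cases hS : H.IsIndepSet (S : Set W)
          · exact mul_le_mul_of_nonneg_left (h S hS) (hw0 S)
          · simp [hwi S hS]
      _ = _ := by rw [sum_mul]

lemma card_le_fractionalChromaticNumber (C : Finset W) (hC : H.IsClique (C : Set W)) :
    (C.card : ℝ) ≤ fractionalChromaticNumber H := by
  classical
  have := sum_le_mul_fractionalChromaticNumber H (fun x => if x ∈ C then 1 else 0)
    (fun x => by positivity) 1 one_pos (fun S hS => by
      rw [← sum_filter, sum_const, nsmul_eq_mul, mul_one]
      have : (S.filter (· ∈ C)).card ≤ 1 := by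
        rw [card_le_one]
        intro a ha b hb
        by_contra hab
        simp only [mem_filter] at ha hb
        exact hS ha.1 hb.1 hab (hC ha.2 hb.2 hab)
      exact_mod_cast this)
  simpa using this

/-- Finitely many independent sets covering every vertex at least `r` times. -/
lemma fractionalChromaticNumber_le {ι : Type*} [Fintype ι] (S : ι → Finset W)
    (hS : ∀ i, H.IsIndepSet (S i : Set W)) (r : ℝ) (hr : 0 < r)
    (hcov : ∀ x, ∃ T : Finset ι, r ≤ T.card ∧ ∀ i ∈ T, x ∈ S i) :
    fractionalChromaticNumber H ≤ Fintype.card ι / r := by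
  classical
  unfold fractionalChromaticNumber
  apply csInf_le
  · refine ⟨0, ?_⟩
    rintro t ⟨w, hw0, -, -, rfl⟩
    exact sum_nonneg fun S _ => hw0 S
  -- Sets may repeat in the family, so `A` is weighted by its multiplicity over `r`.
  · refine ⟨fun A => (univ.filter (fun i => S i = A)).card / r, fun A => by positivity, ?_, ?_, ?_⟩
    · intro A hA
      have : univ.filter (fun i => S i = A) = ∅ := by
        rw [filter_eq_empty_iff]
        rintro i - rfl
        exact hA (hS i)
      simp [this]
    · intro x
      obtain ⟨T, hT, hx⟩ := hcov x
      rw [← sum_div, one_le_div hr]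
      refine hT.trans ?_
      rw [← Nat.cast_sum]
      norm_cast
      rw [card_eq_sum_card_fiberwise (f := S) (s := T)
        (t := univ.filter (fun A : Finset W => x ∈ A))]
      · refine sum_le_sum fun A _ => card_le_card ?_
        exact filter_subset_filter _ (subset_univ _)
      · intro i hi
        simpa using hx i hi
    · rw [← sum_div, ← Nat.cast_sum]
      congr 2
      rw [← card_univ]
      exact card_eq_sum_card_fiberwise fun i _ => by simp

/-- If the independent transversals of a `k`-fold cover meet a set `U` too rarely, the fractional
chromatic number of the cover exceeds `k`. -/
lemma lt_fractionalChromaticNumber {V : Type*} [Fintype V] [Nonempty V] (f : W → V)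
    (hf : ∀ x y, x ≠ y → f x = f y → H.Adj x y) (k : ℕ)
    (hcard : Fintype.card W = k * Fintype.card V) (U : Finset W) (m : ℕ) (hU : k * m < U.card)
    (h : ∀ g : V → W, (∀ v, f (g v) = v) → (∀ u v, ¬ H.Adj (g u) (g v)) →
      ∃ T : Finset V, T.card ≤ m ∧ ∀ v, g v ∈ U → v ∈ T) :
    (k : ℝ) < fractionalChromaticNumber H := by
  classical
  set N := Fintype.card V with hN
  have hN0 : 0 < N := Fintype.card_pos
  -- The dual weight is `N` everywhere plus 1 on `U`. An independent set missing some list has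
  -- weight at most `(N + 1) * (N - 1) < N * N`, so only transversals matter, and these weigh at
  -- most `N * N + m`.
  have key := sum_le_mul_fractionalChromaticNumber H
    (fun x => (N : ℝ) + if x ∈ U then 1 else 0) (fun x => by positivity) (N * N + m)
    (by positivity) (fun S hS => by
      have hinj : Set.InjOn f S := by
        intro a ha b hb hab
        by_contra hne
        exact hS ha hb hne (hf a b hne hab)
      rw [sum_add_distrib, ← sum_filter]
      simp only [sum_const, nsmul_eq_mul, mul_one]
      norm_cast
      have hSN : S.card ≤ N := by
        rw [← card_image_of_injOn hinj, hN, ← card_univ]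
        exact card_le_univ _
      rcases hSN.lt_or_eq with hlt | heq
      · have h1 : (S.filter (· ∈ U)).card ≤ S.card := card_filter_le _ _
        nlinarith
      · have hsurj : S.image f = univ := by
          apply eq_univ_of_card
          rw [card_image_of_injOn hinj, heq]
        have hex : ∀ v, ∃ x ∈ S, f x = v := fun v => by
          have := mem_univ v
          rw [← hsurj] at this
          simpa using this
        choose g hgS hfg using hex
        obtain ⟨T, hTm, hT⟩ := h g hfg (fun u v hadj => hS (hgS u) (hgS v) hadj.ne hadj)
        have : (S.filter (· ∈ U)).card ≤ T.card := by
          refine card_le_card_of_injOn f ?_ (hinj.mono fun x hx => (mem_filter.1 hx).1)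
          intro x hx
          rw [mem_coe, mem_filter] at hx
          have : g (f x) = x := hinj (hgS _) hx.1 (hfg _)
          exact hT _ (by rw [this]; exact hx.2)
        rw [heq]
        omega)
  have htot : ∑ x : W, ((N : ℝ) + if x ∈ U then 1 else 0) = k * N * N + U.card := by
    rw [sum_add_distrib]
    simp [hcard]
  rw [htot] at key
  have hU' : (k : ℝ) * m < U.card := by exact_mod_cast hU
  by_contra hle
  push Not at hle
  have hpos : (0 : ℝ) < N * N + m := by positivity
  nlinarith

end Fractional

/-! ### Correspondence-covers in coordinates -/

section Covers

open Finset

variable {V : Type*}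

/-- The correspondence-cover in which the lists of adjacent vertices are matched by permutations. -/
def permCover (G : SimpleGraph V) {k : ℕ} (p : V → V → Equiv.Perm (Fin k)) :
    SimpleGraph (V × Fin k) where
  Adj a b := (a.1 = b.1 ∧ a.2 ≠ b.2) ∨
    (G.Adj a.1 b.1 ∧ p a.1 b.1 a.2 = b.2 ∧ p b.1 a.1 b.2 = a.2)
  symm := ⟨fun _ _ h => h.imp (fun h => ⟨h.1.symm, h.2.symm⟩) fun h => ⟨h.1.symm, h.2.2, h.2.1⟩⟩
  loopless := ⟨fun _ h => h.elim (fun h => h.2 rfl) fun h => h.1.ne rfl⟩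

lemma permCover_isCorrespondenceCover (G : SimpleGraph V) {k : ℕ}
    (p : V → V → Equiv.Perm (Fin k)) :
    IsCorrespondenceCover G (fun v => ({v} : Finset V) ×ˢ (univ : Finset (Fin k)))
      (permCover G p) where
  partition x := ⟨x.1, by simp, fun v hv => (mem_singleton.1 (mem_product.1 hv).1).symm⟩
  empty u v huv hG x hx y hy h := by
    simp only [mem_product, mem_singleton, mem_univ, and_true] at hx hy
    subst hx hy
    rcases h with h | h
    · exact huv h.1
    · exact hG h.1
  matching u v huv x hx y hy z hz hxy hxz := by
    simp only [mem_product, mem_singleton, mem_univ, and_true] at hx hy hz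
    subst hx hy
    rcases hxy with hxy | hxy
    · exact absurd hxy.1 huv.ne
    rcases hxz with hxz | hxz
    · exact absurd (hxz.1.trans hz) huv.ne
    refine Prod.ext hz.symm ?_
    rw [← hxy.2.1, ← hxz.2.1, hz]
  clique v x hx y hy hxy := by
    simp only [coe_product, coe_singleton, coe_univ, Set.mem_prod, Set.mem_singleton_iff,
      Set.mem_univ, and_true] at hx hy
    exact Or.inl ⟨hx.trans hy.symm, fun h => hxy (Prod.ext (hx.trans hy.symm) h)⟩

lemma ForallCover.permCover {V : Type} [Fintype V] {G : SimpleGraph V} {k : ℕ}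
    {P : ∀ {W : Type} [Fintype W], SimpleGraph W → Prop} (h : ForallCover G k P)
    (p : V → V → Equiv.Perm (Fin k)) : P (permCover G p) :=
  h _ _ _ (permCover_isCorrespondenceCover G p) fun v => by simp

/-- `lt_fractionalChromaticNumber` for covers by permutations. -/
lemma lt_fractionalChromaticNumber_permCover [Fintype V] [Nonempty V] (G : SimpleGraph V) {k : ℕ}
    (p : V → V → Equiv.Perm (Fin k)) (hp : ∀ u v, G.Adj u v → p v u = (p u v)⁻¹)
    (U : Finset (V × Fin k)) (m : ℕ) (hU : k * m < U.card)
    (h : ∀ g : V → Fin k, (∀ u v, G.Adj u v → p u v (g u) ≠ g v) →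
      ∃ T : Finset V, T.card ≤ m ∧ ∀ v, (v, g v) ∈ U → v ∈ T) :
    (k : ℝ) < fractionalChromaticNumber (permCover G p) := by
  refine lt_fractionalChromaticNumber (permCover G p) Prod.fst
    (fun x y hxy hf => Or.inl ⟨hf, fun h => hxy (Prod.ext hf h)⟩) k (by simp [mul_comm]) U m hU ?_
  intro g hg hind
  have hg' : ∀ v, g v = (v, (g v).2) := fun v => Prod.ext (hg v) rfl
  obtain ⟨T, hT, h'⟩ := h (fun v => (g v).2) fun u v huv he => by
    apply hind u v
    rw [hg' u, hg' v]
    refine Or.inr ⟨huv, he, ?_⟩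
    simp only at he ⊢
    rw [hp u v huv, ← he]
    simp
  exact ⟨T, hT, fun v hv => h' v (by rw [← hg' v]; exact hv)⟩

/-- A partial matching between two copies of a finite set extends to a perfect one. -/
lemma exists_perm_of_matching {α : Type*} [Finite α] (R : α → α → Prop)
    (h₁ : ∀ a b c, R a b → R a c → b = c) (h₂ : ∀ a b c, R a c → R b c → a = b) :
    ∃ σ : Equiv.Perm α, ∀ a b, R a b → σ a = b := by
  classical
  have := Fintype.ofFinite α
  choose f hf using fun a : {a // ∃ b, R a b} => a.2
  have hinj : Function.Injective f := fun a b hab =>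
    Subtype.ext (h₂ _ _ _ (hf a) (hab ▸ hf b))
  refine ⟨(Equiv.ofInjective f hinj).extendSubtype (q := fun b => b ∈ Set.range f), fun a b hab => ?_⟩
  rw [Equiv.extendSubtype_apply_of_mem _ a ⟨b, hab⟩]
  exact h₁ _ _ _ (hf ⟨a, b, hab⟩) hab

/-- Coordinates on a `k`-fold correspondence-cover: every list is identified with `Fin k`, and the
matching between two adjacent lists is contained in a perfect matching. -/
lemma IsCorrespondenceCover.exists_coordinates {W : Type*} {G : SimpleGraph V} {L : V → Finset W}
    {H : SimpleGraph W} (hH : IsCorrespondenceCover G L H) {k : ℕ} (hk : ∀ v, (L v).card = k) :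
    ∃ (e : V × Fin k ≃ W) (p : V → V → Equiv.Perm (Fin k)), (∀ a, e a ∈ L a.1) ∧
      ∀ u v, G.Adj u v → ∀ i j, H.Adj (e (u, i)) (e (v, j)) → p u v i = j := by
  classical
  let ε : ∀ v, Fin k ≃ L v := fun v => ((L v).equivFinOfCardEq (hk v)).symm
  let e : V × Fin k → W := fun a => ε a.1 a.2
  have heL : ∀ a, e a ∈ L a.1 := fun a => (ε a.1 a.2).2
  have hbij : Function.Bijective e := by
    constructor
    · rintro ⟨u, i⟩ ⟨v, j⟩ h
      have huv : u = v := (hH.partition (e (u, i))).unique (heL (u, i)) (h ▸ heL (v, j))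
      subst huv
      have : i = j := (ε u).injective (Subtype.ext h)
      rw [this]
    · intro x
      obtain ⟨v, hv, -⟩ := hH.partition x
      exact ⟨(v, (ε v).symm ⟨x, hv⟩), by simp [e]⟩
  have hp : ∀ u v, ∃ σ : Equiv.Perm (Fin k), G.Adj u v → ∀ i j,
      H.Adj (e (u, i)) (e (v, j)) → σ i = j := by
    intro u v
    by_cases huv : G.Adj u v
    · obtain ⟨σ, hσ⟩ := exists_perm_of_matching (fun i j => H.Adj (e (u, i)) (e (v, j)))
        (fun a b c hab hac => by
          have := hH.matching u v huv _ (heL _) _ (heL (v, b)) _ (heL (v, c)) hab hac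
          exact congrArg Prod.snd (hbij.1 this))
        (fun a b c hac hbc => by
          have := hH.matching v u huv.symm _ (heL _) _ (heL (u, a)) _ (heL (u, b)) hac.symm hbc.symm
          exact congrArg Prod.snd (hbij.1 this))
      exact ⟨σ, fun _ => hσ⟩
    · exact ⟨1, fun h => absurd h huv⟩
  choose p hp using hp
  exact ⟨Equiv.ofBijective e hbij, p, heL, hp⟩

/-- A proper transversal in coordinates gives an independent set. -/
lemma IsCorrespondenceCover.isIndepSet_range {W : Type*} {G : SimpleGraph V}
    {L : V → Finset W} {H : SimpleGraph W} (hH : IsCorrespondenceCover G L H) {k : ℕ}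
    (e : V × Fin k ≃ W) (heL : ∀ a, e a ∈ L a.1) (g : V → Fin k)
    (hg : ∀ u v, G.Adj u v → ¬ H.Adj (e (u, g u)) (e (v, g v))) :
    H.IsIndepSet (Set.range fun v => e (v, g v)) := by
  rintro _ ⟨u, rfl⟩ _ ⟨v, rfl⟩ hne hadj
  by_cases huv : G.Adj u v
  · exact hg u v huv hadj
  · refine hH.empty u v ?_ huv _ (heL _) _ (heL _) hadj
    rintro rfl
    exact hne rfl

end Covers

/-! ### The complete bipartite graph `K_{3,3}` -/

section CompleteBipartite

open Finset

/-- To fill `Fin 3` together with `a`, the values `σ x.1` and `τ x.2` must be the other two colours,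
in one of two orders. -/
lemma card_filter_rainbow_le (σ τ : Equiv.Perm (Fin 3)) (a : Fin 3) :
    (univ.filter fun x : Fin 3 × Fin 3 =>
      ∀ z, a = z ∨ σ x.1 = z ∨ τ x.2 = z).card ≤ 2 := by
  revert σ τ a
  decide

/-- Fix colour 0 at the first left vertex. Of the nine choices at the other two, each right vertex
is blocked by at most two, and `3 * 2 < 9`. -/
lemma exists_transversal_completeBipartite (p : Fin 3 → Fin 3 → Equiv.Perm (Fin 3)) :
    ∃ x z : Fin 3 → Fin 3, ∀ i j, p i j (x i) ≠ z j := by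
  classical
  let B : Fin 3 → Finset (Fin 3 × Fin 3) := fun j => univ.filter fun x : Fin 3 × Fin 3 =>
    ∀ z, p 0 j 0 = z ∨ p 1 j x.1 = z ∨ p 2 j x.2 = z
  have hB : (univ.biUnion B).card < (univ : Finset (Fin 3 × Fin 3)).card := by
    refine lt_of_le_of_lt (card_biUnion_le_card_mul _ _ 2 fun j _ => ?_) (by simp)
    exact card_filter_rainbow_le _ _ _
  obtain ⟨x, -, hx⟩ := exists_mem_notMem_of_card_lt_card hB
  have hz : ∀ j, ∃ z, ¬ (p 0 j 0 = z ∨ p 1 j x.1 = z ∨ p 2 j x.2 = z) := by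
    intro j
    by_contra! h
    exact hx (mem_biUnion.2 ⟨j, mem_univ _, mem_filter.2 ⟨mem_univ _, h⟩⟩)
  choose z hz using hz
  refine ⟨![0, x.1, x.2], z, fun i j => ?_⟩
  have := hz j
  push Not at this
  fin_cases i
  · exact this.1
  · exact this.2.1
  · exact this.2.2

lemma forallCover_completeBipartite :
    ForallCover (completeBipartiteGraph (Fin 3) (Fin 3)) 3 fun {W} _ H =>
      ∃ I : Finset W, H.IsIndepSet (I : Set W) ∧ I.card = Fintype.card (Fin 3 ⊕ Fin 3) := by
  classical
  intro W _ L H hH hk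
  obtain ⟨e, p, heL, hp⟩ := hH.exists_coordinates hk
  obtain ⟨x, z, hxz⟩ := exists_transversal_completeBipartite fun i j => p (Sum.inl i) (Sum.inr j)
  have hind := hH.isIndepSet_range e heL (Sum.elim x z) (by
    have key : ∀ i j, ¬ H.Adj (e (Sum.inl i, x i)) (e (Sum.inr j, z j)) := fun i j h =>
      hxz i j (hp _ _ (by simp) _ _ h)
    rintro (i | i) (j | j) huv h
    · simp at huv
    · exact key i j h
    · exact key j i h.symm
    · simp at huv)
  refine ⟨univ.image fun v => e (v, Sum.elim x z v), by simpa using hind, ?_⟩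
  rw [card_image_of_injective, card_univ]
  intro u v h
  exact congrArg Prod.fst (e.injective h)

/-- Permutations on all pairs of vertices of `K_{3,3}` from those on its edges. -/
def bipartitePerm {k : ℕ} (s : Fin 3 → Fin 3 → Equiv.Perm (Fin k)) :
    Fin 3 ⊕ Fin 3 → Fin 3 ⊕ Fin 3 → Equiv.Perm (Fin k)
  | Sum.inl i, Sum.inr j => s i j
  | Sum.inr j, Sum.inl i => (s i j)⁻¹
  | _, _ => 1

lemma lt_fractionalChromaticNumber_completeBipartite {k : ℕ}
    (s : Fin 3 → Fin 3 → Equiv.Perm (Fin k)) (U : Finset ((Fin 3 ⊕ Fin 3) × Fin k)) (m : ℕ)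
    (hU : k * m < U.card)
    (h : ∀ x z : Fin 3 → Fin k, (∀ i j, s i j (x i) ≠ z j) →
      (univ.filter fun v => (v, Sum.elim x z v) ∈ U).card ≤ m) :
    (k : ℝ) < fractionalChromaticNumber
      (permCover (completeBipartiteGraph (Fin 3) (Fin 3)) (bipartitePerm s)) := by
  refine lt_fractionalChromaticNumber_permCover _ _ ?_ U m hU ?_
  · rintro (i | i) (j | j) huv
    · rfl
    · rfl
    · simp [bipartitePerm]
    · rfl
  · intro g hg
    refine ⟨_, h (fun i => g (Sum.inl i)) (fun j => g (Sum.inr j)) fun i j => ?_, fun v hv => ?_⟩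
    · exact hg (Sum.inl i) (Sum.inr j) (by simp)
    · rw [mem_filter]
      refine ⟨mem_univ _, ?_⟩
      rcases v with v | v <;> exact hv

/-- The matchings of a `3`-fold cover of `K_{3,3}` of fractional chromatic number above `3`. -/
def badMatching : Fin 3 → Fin 3 → Equiv.Perm (Fin 3) :=
  ![![1, 1, 1], ![1, 1, Equiv.swap 1 2], ![1, Equiv.swap 0 2, 1]]

/-- A set of ten vertices meeting every independent transversal at most three times. -/
def badSet : Finset ((Fin 3 ⊕ Fin 3) × Fin 3) :=
  {(Sum.inl 0, 2), (Sum.inl 1, 1), (Sum.inl 1, 2), (Sum.inl 2, 0), (Sum.inl 2, 2),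
    (Sum.inr 0, 2), (Sum.inr 1, 0), (Sum.inr 1, 2), (Sum.inr 2, 1), (Sum.inr 2, 2)}

lemma card_filter_badSet_le (x z : Fin 3 → Fin 3) (h : ∀ i j, badMatching i j (x i) ≠ z j) :
    (Finset.univ.filter fun v => (v, Sum.elim x z v) ∈ badSet).card ≤ 3 := by
  revert x z
  decide +kernel

lemma corrChromaticNumber_lt_completeBipartite :
    corrChromaticNumber (completeBipartiteGraph (Fin 3) (Fin 3)) <
      fractionalCorrPackingNumber (completeBipartiteGraph (Fin 3) (Fin 3)) := by
  refine leastPos_lt_leastPos (k := 3) (by norm_num) forallCover_completeBipartite ?_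
  intro k hk0 hk3 h
  have hne : ∀ s : Fin 3 → Fin 3 → Equiv.Perm (Fin k), ¬ (k : ℝ) < fractionalChromaticNumber
      (permCover (completeBipartiteGraph (Fin 3) (Fin 3)) (bipartitePerm s)) := fun s hs =>
    hs.ne' (h.permCover (bipartitePerm s))
  interval_cases k
  · refine hne (fun _ _ => 1) (lt_fractionalChromaticNumber_completeBipartite _ {(Sum.inl 0, 0)} 0
      (by simp) fun x z hxz => ?_)
    exact absurd (Subsingleton.elim _ _) (hxz 0 0)
  -- A single swap on a 4-cycle with identity matchings elsewhere already rules out every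
  -- transversal of a 2-fold cover, so `m = 0` works.
  · refine hne (fun i j => if i = 0 ∧ j = 0 then Equiv.swap 0 1 else 1)
      (lt_fractionalChromaticNumber_completeBipartite _ {(Sum.inl 0, 0)} 0 (by simp)
        fun x z hxz => ?_)
    exfalso
    have h00 := hxz 0 0
    have h01 := hxz 0 1
    have h10 := hxz 1 0
    have h11 := hxz 1 1
    simp only [and_self, if_true, one_ne_zero, and_false, false_and, if_false,
      Equiv.Perm.one_apply] at h00 h01 h10 h11
    revert h00 h01 h10 h11
    generalize x 0 = a
    generalize x 1 = b
    generalize z 0 = c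
    generalize z 1 = d
    revert a b c d
    decide
  · exact hne badMatching (lt_fractionalChromaticNumber_completeBipartite _ badSet 3 (by decide)
      card_filter_badSet_le)

end CompleteBipartite

/-! ### Cycles: fractional versus integral correspondence packing -/

section Cycles

open Finset

lemma cycleGraph_adj_iff {n : ℕ} {u v : Fin (n + 3)} : (SimpleGraph.cycleGraph (n + 3)).Adj u v ↔
    (u : ℕ) + 1 = v ∨ (v : ℕ) + 1 = u ∨ ((u : ℕ) = n + 2 ∧ (v : ℕ) = 0) ∨
      ((v : ℕ) = n + 2 ∧ (u : ℕ) = 0) := by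
  have hsub : ∀ a b : Fin (n + 3), ((a - b : Fin (n + 3)) : ℕ) = 1 ↔
      (b : ℕ) + 1 = a ∨ ((b : ℕ) = n + 2 ∧ (a : ℕ) = 0) := by
    intro a b
    have ha := a.2
    have hb := b.2
    rw [Fin.sub_def]
    simp only
    rcases le_or_gt (b : ℕ) a with h | h
    · rw [show n + 3 - (b : ℕ) + a = (a - b) + (n + 3) by omega, Nat.add_mod_right,
        Nat.mod_eq_of_lt (by omega)]
      omega
    · rw [Nat.mod_eq_of_lt (by omega)]
      omega
  rw [SimpleGraph.cycleGraph_adj', hsub, hsub]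
  tauto

/-- Triples of colours on three consecutive vertices. Each table uses every colour exactly twice in
each position. -/
def cycleTable : Fin 5 → Fin 6 → Fin 3 × Fin 3 × Fin 3 :=
  ![![(0, 2, 1), (1, 0, 2), (2, 1, 0), (0, 2, 1), (1, 0, 2), (2, 1, 0)],
    ![(0, 1, 0), (1, 2, 1), (2, 0, 2), (0, 1, 0), (1, 2, 1), (2, 0, 2)],
    ![(0, 2, 1), (0, 1, 2), (1, 2, 0), (2, 1, 0), (1, 0, 1), (2, 0, 2)],
    ![(1, 0, 2), (1, 2, 0), (2, 0, 1), (0, 2, 1), (2, 1, 2), (0, 1, 0)],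
    ![(2, 1, 0), (2, 0, 1), (0, 1, 2), (1, 0, 2), (0, 2, 0), (1, 2, 1)]]

/-- Tables 0 and 1 serve the identity and the two 3-cycles; tables 2, 3 and 4 serve one
transposition each. -/
lemma exists_cycleTable (r : Equiv.Perm (Fin 3)) : ∃ k, ∀ t,
    (cycleTable k t).1 ≠ (cycleTable k t).2.1 ∧ (cycleTable k t).2.1 ≠ (cycleTable k t).2.2 ∧
      r (cycleTable k t).2.2 ≠ (cycleTable k t).1 := by
  revert r
  decide +kernel

lemma card_cycleTable (k : Fin 5) (y : Fin 3) :
    2 ≤ (univ.filter fun t => (cycleTable k t).1 = y).card ∧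
    2 ≤ (univ.filter fun t => (cycleTable k t).2.1 = y).card ∧
    2 ≤ (univ.filter fun t => (cycleTable k t).2.2 = y).card := by
  revert k y
  decide +kernel

open scoped Fin.CommRing in
/-- The walk on `Fin 3` that starts with a given triple and then increases by one at each step. -/
def cycleWalk (a : Fin 3 × Fin 3 × Fin 3) : ℕ → Fin 3
  | 0 => a.1
  | 1 => a.2.1
  | i + 2 => a.2.2 + i

open scoped Fin.CommRing in
/-- Six walks along a closed cycle of length `n + 3` with identity matchings except for the closing
permutation `r`, which use every colour twice at each vertex. -/
lemma exists_cycleWalks (n : ℕ) (r : Equiv.Perm (Fin 3)) : ∃ h : Fin 6 → ℕ → Fin 3,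
    (∀ t i, h t i ≠ h t (i + 1)) ∧ (∀ t, r (h t (n + 2)) ≠ h t 0) ∧
      ∀ i y, 2 ≤ (univ.filter fun t => h t i = y).card := by
  -- The last value is the third table entry plus `n`, so this translation is absorbed into the
  -- closing permutation. Translations also preserve the colour counts.
  obtain ⟨k, hk⟩ := exists_cycleTable ((Equiv.addRight (n : Fin 3)).trans r)
  refine ⟨fun t => cycleWalk (cycleTable k t), fun t i => ?_, fun t => ?_, fun i y => ?_⟩
  · rcases i with _ | _ | i
    · exact (hk t).1
    · simpa [cycleWalk] using (hk t).2.1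
    · simp only [cycleWalk, Nat.cast_add, Nat.cast_one, ← add_assoc]
      generalize (cycleTable k t).2.2 + (i : Fin 3) = z
      revert z
      decide
  · exact (hk t).2.2
  · rcases i with _ | _ | i
    · exact (card_cycleTable k y).1
    · exact (card_cycleTable k y).2.1
    · simp only [cycleWalk, ← eq_sub_iff_add_eq]
      exact (card_cycleTable k _).2.2

lemma forallCover_cycleGraph (n : ℕ) :
    ForallCover (SimpleGraph.cycleGraph (n + 3)) 3
      fun H => fractionalChromaticNumber H = (3 : ℕ) := by
  classical
  intro W _ L H hH hk
  apply le_antisymm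
  · obtain ⟨e, p, heL, hp⟩ := hH.exists_coordinates hk
    -- `P i` composes the matchings from vertex 0 to vertex `i`. Relabelling by `P` turns every
    -- matching into the identity except on the closing edge.
    let P : ℕ → Equiv.Perm (Fin 3) := fun i => Nat.rec 1
      (fun j Q => p (Fin.ofNat (n + 3) j) (Fin.ofNat (n + 3) (j + 1)) * Q) i
    have hP : ∀ u v : Fin (n + 3), (u : ℕ) + 1 = v → P v = p u v * P u := by
      intro u v huv
      have hu : Fin.ofNat (n + 3) u = u := by simp
      have hv : Fin.ofNat (n + 3) (u + 1) = v := by simp [huv]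
      rw [← huv]
      change p (Fin.ofNat (n + 3) u) (Fin.ofNat (n + 3) (u + 1)) * P u = _
      rw [hu, hv]
    obtain ⟨h, hstep, hclose, hcov⟩ := exists_cycleWalks n
      ((P (n + 2)).trans (p (Fin.last (n + 2)) 0))
    have hind : ∀ t, H.IsIndepSet (Set.range fun v : Fin (n + 3) => e (v, P v (h t v))) := by
      intro t
      refine hH.isIndepSet_range e heL (fun v => P v (h t v)) ?_
      have h1 : ∀ u v : Fin (n + 3), (u : ℕ) + 1 = v →
          ¬ H.Adj (e (u, P u (h t u))) (e (v, P v (h t v))) := by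
        intro u v huv hadj
        have := hp u v (cycleGraph_adj_iff.2 (Or.inl huv)) _ _ hadj
        rw [hP u v huv, Equiv.Perm.mul_apply] at this
        have := (P u).injective ((p u v).injective this)
        rw [← huv] at this
        exact hstep t u this
      have h2 : ∀ u v : Fin (n + 3), (u : ℕ) = n + 2 ∧ (v : ℕ) = 0 →
          ¬ H.Adj (e (u, P u (h t u))) (e (v, P v (h t v))) := by
        intro u v huv hadj
        have := hp u v (cycleGraph_adj_iff.2 (Or.inr (Or.inr (Or.inl huv)))) _ _ hadj
        have hu : u = Fin.last (n + 2) := Fin.ext huv.1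
        have hv : v = 0 := Fin.ext huv.2
        subst hu hv
        exact hclose t this
      intro u v huv hadj
      rcases cycleGraph_adj_iff.1 huv with h | h | h | h
      · exact h1 u v h hadj
      · exact h1 v u h hadj.symm
      · exact h2 u v h hadj
      · exact h2 v u h hadj.symm
    have := fractionalChromaticNumber_le H
      (fun t => univ.image fun v : Fin (n + 3) => e (v, P v (h t v)))
      (fun t => by simpa using hind t) 2 two_pos (fun x => by
        obtain ⟨⟨v, j⟩, rfl⟩ := e.surjective x
        refine ⟨univ.filter fun t => h t v = (P v).symm j, by exact_mod_cast hcov _ _,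
          fun t ht => mem_image.2 ⟨v, mem_univ _, ?_⟩⟩
        rw [(mem_filter.1 ht).2, Equiv.apply_symm_apply])
    refine this.trans ?_
    norm_num
  · have := card_le_fractionalChromaticNumber H (L 0) (hH.clique 0)
    rwa [hk 0] at this

/-- Identity matchings along a cycle, except for the permutation `σ` on the closing edge. -/
def twist {k : ℕ} (n : ℕ) (σ : Equiv.Perm (Fin k)) (u v : Fin (n + 3)) : Equiv.Perm (Fin k) :=
  if u = Fin.last (n + 2) ∧ v = 0 then σ else if u = 0 ∧ v = Fin.last (n + 2) then σ⁻¹ else 1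

/-- A `k`-colouring of the cover is a permutation `π v` at each vertex, and across an edge the two
permutations differ by a derangement. If all derangements have sign `ε`, going once round the cycle
forces the closing permutation to have sign `ε ^ (n + 3)`. -/
lemma not_colorable_twist (n : ℕ) {k : ℕ} (ε : ℤˣ)
    (hε : ∀ δ : Equiv.Perm (Fin k), (∀ i, δ i ≠ i) → Equiv.Perm.sign δ = ε)
    (σ : Equiv.Perm (Fin k)) (hσ : Equiv.Perm.sign σ ≠ ε ^ (n + 3)) :
    ¬ (permCover (SimpleGraph.cycleGraph (n + 3)) (twist n σ)).Colorable k := by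
  rintro ⟨C⟩
  have hbij : ∀ v, Function.Bijective fun i => C (v, i) := fun v =>
    Finite.injective_iff_bijective.1 fun i j hij => by
      by_contra hne
      exact C.valid (Or.inl ⟨rfl, hne⟩ : (permCover _ (twist n σ)).Adj (v, i) (v, j)) hij
  let π : Fin (n + 3) → Equiv.Perm (Fin k) := fun v => Equiv.ofBijective _ (hbij v)
  have hπ : ∀ v i, π v i = C (v, i) := fun v i => rfl
  have hstep : ∀ u v : Fin (n + 3), (u : ℕ) + 1 = v →
      Equiv.Perm.sign (π v) = Equiv.Perm.sign (π u) * ε := by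
    intro u v huv
    have h1 := hε ((π u)⁻¹ * π v) fun i hi => by
      rw [Equiv.Perm.mul_apply, Equiv.Perm.inv_eq_iff_eq] at hi
      refine C.valid (v := (u, i)) (w := (v, i))
        (Or.inr ⟨cycleGraph_adj_iff.2 (Or.inl huv), ?_, ?_⟩) hi.symm
      · rw [twist, if_neg, if_neg]
        · rfl
        · rintro ⟨rfl, rfl⟩
          simp at huv
        · rintro ⟨rfl, rfl⟩
          simp at huv
      · rw [twist, if_neg, if_neg]
        · rfl
        · rintro ⟨rfl, rfl⟩
          simp at huv
        · rintro ⟨rfl, rfl⟩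
          simp at huv
    rw [← h1, Equiv.Perm.sign_mul, Equiv.Perm.sign_inv, ← mul_assoc, Int.units_mul_self, one_mul]
  have hsign : ∀ i (hi : i < n + 3),
      Equiv.Perm.sign (π ⟨i, hi⟩) = Equiv.Perm.sign (π 0) * ε ^ i := by
    intro i
    induction i with
    | zero => intro hi; simp
    | succ i ih =>
      intro hi
      rw [hstep ⟨i, by omega⟩ ⟨i + 1, hi⟩ rfl, ih, pow_succ, mul_assoc]
  have hlast := hε ((π (Fin.last (n + 2)))⁻¹ * (π 0 * σ)) fun i hi => by
    rw [Equiv.Perm.mul_apply, Equiv.Perm.inv_eq_iff_eq, Equiv.Perm.mul_apply] at hi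
    refine C.valid (v := (Fin.last (n + 2), i)) (w := (0, σ i))
      (Or.inr ⟨cycleGraph_adj_iff.2 (by simp), ?_, ?_⟩) hi.symm
    · simp [twist]
    · simp [twist, Fin.ext_iff]
  rw [Equiv.Perm.sign_mul, Equiv.Perm.sign_inv, Equiv.Perm.sign_mul] at hlast
  have h2 := hsign (n + 2) (by omega)
  change Equiv.Perm.sign (π (Fin.last (n + 2))) = _ at h2
  apply hσ
  rw [h2] at hlast
  rw [pow_succ]
  generalize ε ^ (n + 2) = a at hlast ⊢
  generalize Equiv.Perm.sign (π 0) = b at hlast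
  generalize Equiv.Perm.sign σ = c at hlast ⊢
  clear * - hlast
  revert a b c ε
  decide

lemma fractionalCorrPackingNumber_lt_cycleGraph (n : ℕ) :
    fractionalCorrPackingNumber (SimpleGraph.cycleGraph (n + 3)) <
      corrPackingNumber (SimpleGraph.cycleGraph (n + 3)) := by
  refine leastPos_lt_leastPos (k := 3) (by norm_num) (forallCover_cycleGraph n) ?_
  intro k hk0 hk3 h
  have hne : ∀ σ : Equiv.Perm (Fin k),
      (permCover (SimpleGraph.cycleGraph (n + 3)) (twist n σ)).Colorable k := fun σ =>
    SimpleGraph.chromaticNumber_le_iff_colorable.1 (h.permCover (twist n σ)).le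
  interval_cases k
  · obtain ⟨C⟩ := hne 1
    refine C.valid (v := ((0 : Fin (n + 3)), (0 : Fin 1))) (w := (1, 0))
      (Or.inr ⟨cycleGraph_adj_iff.2 (by simp), Subsingleton.elim _ _, Subsingleton.elim _ _⟩)
      (Subsingleton.elim _ _)
  -- The only derangement of two points is odd, so the parity of the cycle decides which `σ`
  -- obstructs. For three points the derangements are 3-cycles, hence even, and a transposition
  -- always obstructs.
  · have hε : ∀ δ : Equiv.Perm (Fin 2), (∀ i, δ i ≠ i) → Equiv.Perm.sign δ = -1 := by decide
    by_cases h1 : (1 : ℤˣ) = (-1) ^ (n + 3)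
    · exact not_colorable_twist n (-1) hε (Equiv.swap 0 1) (by rw [← h1]; decide) (hne _)
    · exact not_colorable_twist n (-1) hε 1 (by simpa using h1) (hne _)
  · exact not_colorable_twist n 1 (by decide) (Equiv.swap 0 1) (by rw [one_pow]; decide) (hne _)

end Cycles

/-! ### Fractional chromatic number of list-covers -/

section ListCovers

open Finset

variable {V : Type*} [Fintype V] {G : SimpleGraph V} {L : V → Finset ℕ} {k : ℕ}

/-- The duality bound with a one-element `U` and `m = 0`: one unusable colour in one list suffices.
-/
lemma lt_fractionalChromaticNumber_listCover [Nonempty V] (hL : IsListAssignment k L) (v₀ : V)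
    (x₀ : ℕ) (hx₀ : x₀ ∈ L v₀) (h : ∀ c, IsListColouring G L c → c v₀ ≠ x₀) :
    (k : ℝ) < fractionalChromaticNumber (listCover G L) := by
  refine lt_fractionalChromaticNumber (listCover G L) Sigma.fst
    (fun x y hxy hf => ⟨hxy, Or.inl hf⟩) k ?_ {⟨v₀, x₀, hx₀⟩} 0 (by simp) ?_
  · simp [Fintype.card_sigma, hL _, mul_comm]
  · intro g hg hind
    refine ⟨∅, by simp, fun v hv => ?_⟩
    rw [mem_singleton] at hv
    have hv₀ : v = v₀ := by rw [← hg v, hv]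
    subst hv₀
    refine absurd (congrArg (fun p : (v : V) × L v => (p.2 : ℕ)) hv)
      (h (fun v => (g v).2) ⟨fun v => ?_, fun u v huv he => hind u v ⟨?_, Or.inr ⟨?_, he⟩⟩⟩)
    · exact (congrArg L (hg v)).subset (g v).2.2
    · intro h
      have := congrArg Sigma.fst h
      rw [hg, hg] at this
      exact huv.ne this
    · rwa [hg, hg]

lemma card_le_fractionalChromaticNumber_listCover (v : V) :
    ((L v).card : ℝ) ≤ fractionalChromaticNumber (listCover G L) := by
  classical
  have := card_le_fractionalChromaticNumber (listCover G L)
    (univ.image fun x : L v => (⟨v, x⟩ : (v : V) × L v)) (by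
      intro a ha b hb hab
      simp only [coe_image, coe_univ, Set.image_univ, Set.mem_range] at ha hb
      obtain ⟨x, rfl⟩ := ha
      obtain ⟨y, rfl⟩ := hb
      exact ⟨hab, Or.inl rfl⟩)
  rwa [card_image_of_injective _ sigma_mk_injective, card_univ, Fintype.card_coe] at this

lemma fractionalChromaticNumber_listCover_le {ι : Type*} [Fintype ι] (c : ι → V → ℕ)
    (hc : ∀ i, IsListColouring G L (c i)) (r : ℝ) (hr : 0 < r)
    (hcov : ∀ v, ∀ x ∈ L v, ∃ T : Finset ι, r ≤ T.card ∧ ∀ i ∈ T, c i v = x) :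
    fractionalChromaticNumber (listCover G L) ≤ Fintype.card ι / r := by
  classical
  refine fractionalChromaticNumber_le (listCover G L)
    (fun i => univ.image fun v => ⟨v, c i v, (hc i).1 v⟩) ?_ r hr ?_
  · intro i a ha b hb hab hadj
    simp only [coe_image, coe_univ, Set.image_univ, Set.mem_range] at ha hb
    obtain ⟨u, rfl⟩ := ha
    obtain ⟨v, rfl⟩ := hb
    rcases hadj.2 with h | h
    · simp only at h
      subst h
      exact hab rfl
    · exact (hc i).2 u v h.1 h.2
  · rintro ⟨v, x, hx⟩
    obtain ⟨T, hT, h⟩ := hcov v x hx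
    refine ⟨T, hT, fun i hi => mem_image.2 ⟨v, mem_univ _, ?_⟩⟩
    have := h i hi
    subst this
    rfl

end ListCovers

/-! ### Even cycles: list colouring versus fractional list packing -/

section EvenCycles

open Finset

/-- A list-assignment of a cycle for which the colour `0` cannot be used at the vertex `0`. -/
def cycleList (n : ℕ) (v : Fin (n + 3)) : Finset ℕ :=
  {if (v : ℕ) = 0 then n + 3 else (v : ℕ) - 1, if (v : ℕ) = n + 2 then 0 else (v : ℕ)}

lemma cycleList_isListAssignment (n : ℕ) : IsListAssignment 2 (cycleList n) := by
  intro v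
  have := v.2
  apply card_pair
  split_ifs <;> omega

/-- Colour 0 at vertex 0 forces colour `i` at each vertex `i ≤ n + 1`; the last vertex, with list
`{n + 1, 0}`, is then blocked from both sides. -/
lemma cycleList_colouring_ne (n : ℕ) (c : Fin (n + 3) → ℕ)
    (hc : IsListColouring (SimpleGraph.cycleGraph (n + 3)) (cycleList n) c) : c 0 ≠ 0 := by
  intro h0
  have hi : ∀ i (hi : i < n + 2), c ⟨i, by omega⟩ = i := by
    intro i
    induction i with
    | zero => exact fun _ => h0
    | succ i ih =>
      intro hi
      have h1 := ih (by omega)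
      have h2 := hc.1 ⟨i + 1, by omega⟩
      have h3 := hc.2 ⟨i, by omega⟩ ⟨i + 1, by omega⟩ (cycleGraph_adj_iff.2 (Or.inl rfl))
      simp only [cycleList, mem_insert, mem_singleton] at h2
      rw [if_neg (by omega), if_neg (by omega)] at h2
      omega
  have h1 := hi (n + 1) (by omega)
  have h2 := hc.1 ⟨n + 2, by omega⟩
  have h3 := hc.2 ⟨n + 1, by omega⟩ ⟨n + 2, by omega⟩ (cycleGraph_adj_iff.2 (Or.inl rfl))
  have h4 := hc.2 ⟨n + 2, by omega⟩ 0 (cycleGraph_adj_iff.2 (Or.inr (Or.inr (Or.inl ⟨rfl, rfl⟩))))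
  simp only [cycleList, mem_insert, mem_singleton] at h2
  rw [if_neg (by omega), if_pos trivial] at h2
  omega

lemma exists_listColouring_even_cycle (n : ℕ) (hn : Even (n + 3)) (L : Fin (n + 3) → Finset ℕ)
    (hL : IsListAssignment 2 L) :
    ∃ c, IsListColouring (SimpleGraph.cycleGraph (n + 3)) L c := by
  classical
  by_cases hconst : ∀ i, L (i + 1) = L i
  · have hL0 : ∀ v, L v = L 0 := by
      have : ∀ j : ℕ, L (Fin.ofNat (n + 3) j) = L 0 := by
        intro j
        induction j with
        | zero => rfl
        | succ j ih =>
          refine ((congrArg L (Fin.ext ?_)).trans (hconst (Fin.ofNat (n + 3) j))).trans ih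
          simp [Fin.val_add]
      intro v
      simpa using this v
    obtain ⟨a, b, hab, h0⟩ := card_eq_two.1 (hL 0)
    let C := SimpleGraph.cycleGraph.bicoloring_of_even (n + 3) hn
    refine ⟨fun v => if C v then a else b, fun v => ?_, fun u v huv => ?_⟩
    · rw [hL0 v, h0]
      dsimp only
      split_ifs <;> simp
    · have := C.valid huv
      dsimp only
      revert this
      generalize C u = p
      generalize C v = q
      cases p <;> cases q <;> simp [hab, hab.symm]
  · push Not at hconst
    obtain ⟨i₀, hi₀⟩ := hconst
    obtain ⟨x, hx, hx'⟩ : ∃ x ∈ L i₀, x ∉ L (i₀ + 1) := by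
      by_contra! h
      exact hi₀ (eq_of_subset_of_card_le h (by rw [hL, hL])).symm
    have hex : ∀ v y, ∃ z ∈ L v, z ≠ y := fun v y =>
      exists_mem_ne (by rw [hL v]; norm_num) y
    choose f hfL hfne using hex
    -- `d j` colours the vertex `i₀ - j`: starting from `x` at `i₀`, go backwards greedily avoiding
    -- the previous colour. The walk ends at `i₀ + 1`, whose list lacks `x`, so the closing edge is
    -- safe. Evenness matters only for constant lists.
    let d : ℕ → ℕ := fun j => Nat.rec x (fun j y => f (i₀ - Fin.ofNat (n + 3) (j + 1)) y) j
    have hdL : ∀ v, d (i₀ - v : Fin (n + 3)) ∈ L v := by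
      intro v
      rcases hj : ((i₀ - v : Fin (n + 3)) : ℕ) with _ | j
      · have : i₀ - v = 0 := Fin.ext hj
        rw [sub_eq_zero] at this
        rwa [← this]
      · have : Fin.ofNat (n + 3) (j + 1) = i₀ - v := by simp [← hj]
        change f (i₀ - Fin.ofNat (n + 3) (j + 1)) (d j) ∈ L v
        rw [this, sub_sub_cancel]
        exact hfL _ _
    have key : ∀ u, d (i₀ - u : Fin (n + 3)) ≠ d (i₀ - (u + 1) : Fin (n + 3)) := by
      intro u
      by_cases hu : u = i₀
      · subst hu
        intro h
        apply hx'
        have := hdL (u + 1)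
        rw [← h, sub_self] at this
        exact this
      · have h1 : i₀ - u = (i₀ - (u + 1)) + 1 := by abel
        have hval : ((i₀ - u : Fin (n + 3)) : ℕ) = ((i₀ - (u + 1) : Fin (n + 3)) : ℕ) + 1 := by
          rw [h1, Fin.val_add_one, if_neg]
          intro hlast
          rw [hlast, Fin.last_add_one, sub_eq_zero] at h1
          exact hu h1.symm
        rw [hval]
        exact hfne _ _
    refine ⟨fun v => d (i₀ - v : Fin (n + 3)), hdL, fun u v huv => ?_⟩
    rcases SimpleGraph.cycleGraph_adj.1 huv with h | h
    · rw [sub_eq_iff_eq_add'] at h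
      subst h
      exact (key v).symm
    · rw [sub_eq_iff_eq_add'] at h
      subst h
      exact key u

lemma listChromaticNumber_lt_even_cycle (n : ℕ) (hn : Even (n + 3)) :
    listChromaticNumber (SimpleGraph.cycleGraph (n + 3)) <
      fractionalListPackingNumber (SimpleGraph.cycleGraph (n + 3)) := by
  refine leastPos_lt_leastPos (k := 2) (by norm_num) (exists_listColouring_even_cycle n hn) ?_
  intro k hk0 hk2 h
  interval_cases k
  · have hL : IsListAssignment 1 fun _ : Fin (n + 3) => ({0} : Finset ℕ) := fun v => rfl
    refine (lt_fractionalChromaticNumber_listCover hL 0 0 (by simp) fun c hc => ?_).ne' (h _ hL)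
    have h0 := hc.1 0
    have h1 := hc.1 1
    have := hc.2 0 1 (cycleGraph_adj_iff.2 (by simp))
    simp_all
  · exact (lt_fractionalChromaticNumber_listCover (cycleList_isListAssignment n) 0 0
      (by simp [cycleList]) (cycleList_colouring_ne n)).ne' (h _ (cycleList_isListAssignment n))

end EvenCycles

/-! ### The fan: fractional versus integral list packing -/

section Fans

open Finset

/-- Two disjoint colourings of a path whose lists have size two. -/
lemma exists_two_path_colourings (M : ℕ → Finset ℕ) (hM : ∀ j, (M j).card = 2) :
    ∃ d : Bool → ℕ → ℕ, (∀ i j, d i j ∈ M j) ∧ (∀ i j, d i j ≠ d i (j + 1)) ∧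
      ∀ j, ∀ y ∈ M j, ∃ i, d i j = y := by
  -- If one ordering of a two-element list clashes with a pair of distinct colours, the reverse
  -- ordering does not.
  have hstep : ∀ (j : ℕ) (q : ℕ × ℕ), ∃ q' : ℕ × ℕ, q.1 ≠ q.2 →
      (M j = {q'.1, q'.2} ∧ q'.1 ≠ q'.2 ∧ q.1 ≠ q'.1 ∧ q.2 ≠ q'.2) := by
    intro j q
    obtain ⟨a, b, hab, h⟩ := card_eq_two.1 (hM j)
    by_cases h' : q.1 ≠ a ∧ q.2 ≠ b
    · exact ⟨(a, b), fun _ => ⟨h, hab, h'.1, h'.2⟩⟩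
    · exact ⟨(b, a), fun hq => ⟨by rw [h, pair_comm], hab.symm, by grind, by grind⟩⟩
  choose f hf using hstep
  obtain ⟨a, b, hab, h0⟩ := card_eq_two.1 (hM 0)
  let Q : ℕ → ℕ × ℕ := fun j => Nat.rec (a, b) (fun j q => f (j + 1) q) j
  have hQ : ∀ j, (Q j).1 ≠ (Q j).2 := by
    intro j
    induction j with
    | zero => exact hab
    | succ j ih => exact (hf (j + 1) (Q j) ih).2.1
  have hQM : ∀ j, M j = {(Q j).1, (Q j).2} := by
    rintro (_ | j)
    · exact h0
    · exact (hf (j + 1) (Q j) (hQ j)).1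
  refine ⟨fun i j => if i then (Q j).1 else (Q j).2, fun i j => ?_, fun i j => ?_, fun j y hy => ?_⟩
  · rw [hQM j]
    cases i <;> simp
  · have := hf (j + 1) (Q j) (hQ j)
    cases i
    · exact this.2.2.2
    · exact this.2.2.1
  · rw [hQM j, mem_insert, mem_singleton] at hy
    rcases hy with hy | hy
    · exact ⟨true, hy.symm⟩
    · exact ⟨false, hy.symm⟩

/-- A bijection between lists that fixes the common colours. -/
lemma exists_equiv_fixing_inter {A B : Finset ℕ} (h : A.card = B.card) :
    ∃ φ : A ≃ B, ∀ x : A, (x : ℕ) ∈ B → (φ x : ℕ) = x := by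
  obtain ⟨g, hg⟩ := exists_equiv_extend_of_card_eq (α := A) (t := B) (by simpa using h)
    (s := univ.filter fun x : A => (x : ℕ) ∈ B) (f := Subtype.val)
    (by
      intro y hy
      obtain ⟨x, hx, rfl⟩ := mem_image.1 hy
      exact (mem_filter.1 hx).2)
    (Subtype.val_injective.injOn)
  exact ⟨g, fun x hx => hg x (mem_filter.2 ⟨mem_univ _, hx⟩)⟩

lemma fractionalChromaticNumber_listCover_fanGraph (m : ℕ) (L : Option (Fin m) → Finset ℕ)
    (hL : IsListAssignment 3 L) :
    fractionalChromaticNumber (listCover (fanGraph m) L) = (3 : ℕ) := by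
  classical
  apply le_antisymm
  -- As `φ` fixes common colours, deleting the image of the hub colour `x` also deletes `x` itself
  -- wherever it occurs.
  · choose φ hφ using fun v => exists_equiv_fixing_inter ((hL none).trans (hL v).symm)
    let M : L none → ℕ → Finset ℕ := fun x j =>
      -- Beyond the path, `{0, 1}` is a dummy list of size two.
      if hj : j < m then (L (some ⟨j, hj⟩)).erase (φ (some ⟨j, hj⟩) x) else {0, 1}
    have hM : ∀ x j, (M x j).card = 2 := by
      intro x j
      by_cases hj : j < m
      · simp only [M, dif_pos hj]
        rw [card_erase_of_mem (φ _ x).2, hL]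
      · simp [M, dif_neg hj]
    have hMv : ∀ x (j : Fin m), M x j = (L (some j)).erase (φ _ x) := fun _ j => dif_pos j.2
    choose d hdM hdne hdex using fun x => exists_two_path_colourings (M x) (hM x)
    have hd : ∀ x i (j : Fin m), d x i j ∈ L (some j) ∧ d x i j ≠ φ (some j) x := by
      intro x i j
      have := hdM x i j
      rw [hMv, mem_erase] at this
      exact this.symm
    let c : L none × Bool → Option (Fin m) → ℕ := fun a v =>
      v.elim (a.1 : ℕ) fun j => d a.1 a.2 j
    have hne : ∀ a (j : Fin m), c a none ≠ c a (some j) := by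
      intro a j h
      change (a.1 : ℕ) = d a.1 a.2 j at h
      obtain ⟨h1, h2⟩ := hd a.1 a.2 j
      rw [← h] at h1 h2
      exact h2 (hφ _ _ h1).symm
    have hc : ∀ a, IsListColouring (fanGraph m) L (c a) := by
      intro a
      refine ⟨fun v => ?_, fun u v huv => ?_⟩
      · rcases v with _ | j
        · exact a.1.2
        · exact (hd _ _ _).1
      · rcases u with _ | i <;> rcases v with _ | j
        · exact absurd rfl huv.1
        · exact hne a j
        · exact (hne a i).symm
        · obtain ⟨i', j', hi, hj, hij⟩ := (huv.2.resolve_left (by simp)).resolve_left (by simp)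
          cases hi
          cases hj
          rcases SimpleGraph.pathGraph_adj.1 hij with h | h
          · change d a.1 a.2 i ≠ d a.1 a.2 j
            rw [← h]
            exact hdne _ _ _
          · change d a.1 a.2 i ≠ d a.1 a.2 j
            rw [← h]
            exact (hdne _ _ _).symm
    have := fractionalChromaticNumber_listCover_le c hc 2 two_pos (by
      intro v y hy
      rcases v with _ | j
      · refine ⟨univ.image fun b => (⟨y, hy⟩, b), ?_, ?_⟩
        · rw [card_image_of_injective _ (Prod.mk_right_injective _)]
          simp
        · intro i hi
          obtain ⟨b, -, rfl⟩ := mem_image.1 hi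
          rfl
      -- Only the hub colour `x₀` deletes `y` at this vertex; each of the other two gives a path
      -- colouring using `y`, hence coverage 2.
      · let x₀ := (φ (some j)).symm ⟨y, hy⟩
        have hx : ∀ x, ∃ b, x ≠ x₀ → d x b j = y := by
          intro x
          by_cases hxx : x = x₀
          · exact ⟨true, fun h => absurd hxx h⟩
          · have hmem : y ∈ M x j := by
              rw [hMv, mem_erase]
              refine ⟨fun h => hxx ?_, hy⟩
              rw [Equiv.eq_symm_apply]
              exact Subtype.ext h.symm
            obtain ⟨b, hb⟩ := hdex x j y hmem
            exact ⟨b, fun _ => hb⟩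
        choose b hb using hx
        refine ⟨(univ.erase x₀).image fun x => (x, b x), ?_, ?_⟩
        · rw [card_image_of_injective _ fun x y h => congrArg Prod.fst h,
            card_erase_of_mem (mem_univ _), card_univ, Fintype.card_coe, hL]
          norm_num
        · intro i hi
          obtain ⟨x, hx, rfl⟩ := mem_image.1 hi
          exact hb x (ne_of_mem_erase hx))
    refine this.trans ?_
    rw [Fintype.card_prod, Fintype.card_coe, hL]
    norm_num
  · have := card_le_fractionalChromaticNumber_listCover (G := fanGraph m) (L := L) none
    rwa [hL] at this

/-- The injective triples of colours from a list. -/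
def triples (A : Finset ℕ) : Finset (ℕ × ℕ × ℕ) :=
  (A ×ˢ A ×ˢ A).filter fun t => t.1 ≠ t.2.1 ∧ t.1 ≠ t.2.2 ∧ t.2.1 ≠ t.2.2

/-- Triples that differ in every position. -/
abbrev Apart (s t : ℕ × ℕ × ℕ) : Prop :=
  s.1 ≠ t.1 ∧ s.2.1 ≠ t.2.1 ∧ s.2.2 ≠ t.2.2

/-- A `3`-list-assignment of the fan without a packing of size three. -/
def fanList (v : Option (Fin 6)) : Finset ℕ :=
  v.elim {0, 1, 2} ![{0, 1, 2}, {0, 1, 3}, {0, 2, 3}, {0, 2, 3}, {0, 1, 3}, {0, 1, 2}]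

set_option synthInstance.maxHeartbeats 400000 in
set_option synthInstance.maxSize 4000 in
-- Up to reordering the colourings, the hub triple is `(0, 1, 2)`. Then `a` and `b` force `c` to be
-- `(2, 3, 0)` or `(2, 0, 3)`. The lists are palindromic, so the same holds for `d`, and `c`, `d`
-- clash in the first position. Each condition is placed as early as possible to prune the finite
-- check.
lemma not_exists_fan_triples : ∀ u ∈ triples {0, 1, 2},
    ∀ a ∈ triples {0, 1, 2}, Apart u a → ∀ b ∈ triples {0, 1, 3}, Apart u b → Apart a b →
    ∀ c ∈ triples {0, 2, 3}, Apart u c → Apart b c → ∀ d ∈ triples {0, 2, 3}, Apart u d →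
    Apart c d → ∀ e ∈ triples {0, 1, 3}, Apart u e → Apart d e → ∀ f ∈ triples {0, 1, 2},
    Apart u f → ¬ Apart e f := by
  decide +kernel

lemma fanGraph_adj_none (m : ℕ) (i : Fin m) : (fanGraph m).Adj none (some i) :=
  ⟨by simp, Or.inl rfl⟩

lemma fanGraph_adj_some (m : ℕ) (i j : Fin m) (h : (i : ℕ) + 1 = j) :
    (fanGraph m).Adj (some i) (some j) :=
  ⟨fun h' => by cases h'; omega,
    Or.inr (Or.inr ⟨i, j, rfl, rfl, SimpleGraph.pathGraph_adj.2 (Or.inl h)⟩)⟩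

lemma fanList_not_packing (c : Fin 3 → Option (Fin 6) → ℕ) :
    ¬ IsListPacking (fanGraph 6) fanList 3 c := by
  intro hc
  let T : Option (Fin 6) → ℕ × ℕ × ℕ := fun v => (c 0 v, c 1 v, c 2 v)
  have hT : ∀ v, T v ∈ triples (fanList v) := by
    intro v
    simp only [triples, mem_filter, mem_product, T]
    exact ⟨⟨(hc.1 0).1 v, (hc.1 1).1 v, (hc.1 2).1 v⟩, hc.2 0 1 (by decide) v,
      hc.2 0 2 (by decide) v, hc.2 1 2 (by decide) v⟩
  have hA : ∀ u v, (fanGraph 6).Adj u v → Apart (T u) (T v) := fun u v huv =>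
    ⟨(hc.1 0).2 u v huv, (hc.1 1).2 u v huv, (hc.1 2).2 u v huv⟩
  have hn := fun i => hA _ _ (fanGraph_adj_none 6 i)
  have hs := fun i j h => hA _ _ (fanGraph_adj_some 6 i j h)
  exact not_exists_fan_triples (T none) (hT none) (T (some 0)) (hT (some 0)) (hn 0)
    (T (some 1)) (hT (some 1)) (hn 1) (hs 0 1 rfl) (T (some 2)) (hT (some 2)) (hn 2) (hs 1 2 rfl)
    (T (some 3)) (hT (some 3)) (hn 3) (hs 2 3 rfl) (T (some 4)) (hT (some 4)) (hn 4) (hs 3 4 rfl)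
    (T (some 5)) (hT (some 5)) (hn 5) (hs 4 5 rfl)

lemma fractionalListPackingNumber_lt_fanGraph :
    fractionalListPackingNumber (fanGraph 6) < listPackingNumber (fanGraph 6) := by
  refine leastPos_lt_leastPos (k := 3) (by norm_num)
    (fractionalChromaticNumber_listCover_fanGraph 6) ?_
  intro k hk0 hk3 h
  rcases hk3.lt_or_eq with hk | rfl
  -- The hub and two consecutive path vertices form a triangle, which fewer than three common
  -- colours cannot colour.
  · obtain ⟨c, hc, -⟩ := h (fun _ => range k) fun v => by simp
    obtain ⟨hmem, hne⟩ := hc ⟨0, hk0⟩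
    have h1 := hne _ _ (fanGraph_adj_none 6 0)
    have h2 := hne _ _ (fanGraph_adj_none 6 1)
    have h3 := hne _ _ (fanGraph_adj_some 6 0 1 rfl)
    have h4 := mem_range.1 (hmem none)
    have h5 := mem_range.1 (hmem (some 0))
    have h6 := mem_range.1 (hmem (some 1))
    omega
  · obtain ⟨c, hc⟩ := h fanList (by unfold IsListAssignment; decide)
    exact fanList_not_packing c hc

end Fans

end ListPacking

theorem proposition1p9 :
    (∀ n : ℕ, 2 ≤ n →
      ListPacking.listChromaticNumber (SimpleGraph.cycleGraph (2 * n)) <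
        ListPacking.fractionalListPackingNumber (SimpleGraph.cycleGraph (2 * n))) ∧
    ListPacking.fractionalListPackingNumber (ListPacking.fanGraph 6) <
      ListPacking.listPackingNumber (ListPacking.fanGraph 6) ∧
    ListPacking.corrChromaticNumber (completeBipartiteGraph (Fin 3) (Fin 3)) <
      ListPacking.fractionalCorrPackingNumber (completeBipartiteGraph (Fin 3) (Fin 3)) ∧
    (∀ n : ℕ, 3 ≤ n →
      ListPacking.fractionalCorrPackingNumber (SimpleGraph.cycleGraph n) <
        ListPacking.corrPackingNumber (SimpleGraph.cycleGraph n)) := by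
  refine ⟨fun n hn => ?_, ListPacking.fractionalListPackingNumber_lt_fanGraph,
    ListPacking.corrChromaticNumber_lt_completeBipartite, fun n hn => ?_⟩
  · obtain ⟨m, hm⟩ := Nat.exists_eq_add_of_le' (show 3 ≤ 2 * n by omega)
    rw [hm]
    exact ListPacking.listChromaticNumber_lt_even_cycle m (hm ▸ even_two_mul n)
  · obtain ⟨m, rfl⟩ := Nat.exists_eq_add_of_le' hn
    exact ListPacking.fractionalCorrPackingNumber_lt_cycleGraph m
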